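/- Let $X$ be a real locally convex Hausdorff topological vector space with topological dual $X^*$, let $T$ be an arbitrary index set (finite or infinite), and let $f$ and $f_t$ ($t\in T$) be lower semicontinuous proper convex functions $X\to\mathbb{R}\cup\{+\infty\}$. Put $E=\{x\in X: f_t(x)\le 0 \text{ for all } t\in T\}$ and $\mathrm{dom} f=\{x\in X: f(x)<+\infty\}$, assume $E\cap \mathrm{dom} f\neq\emptyset$, and consider the problem $(\mathrm{P})$ of minimizing $f$ over $E$, with optimal value $\inf(\mathrm{P})=\inf_{x\in E}f(x)$ and optimal solution set $\mathrm{sol}(\mathrm{P})$. Let $\mathcal{H}$ be a nonempty family of nonempty finite subsets of $T$ that is covering, i.e. $\bigcup_{H\in\mathcal{H}}H=T$. With the rule $0\times(+\infty)=0$, put $$\sup(\mathrm{D}_{\mathcal{H}})=\sup_{H\in\mathcal{H},\ \mu\in\mathbb{R}_+^H}\ \inf_{x\in X}\Big\{f(x)+\sum_{t\in H}\mu_t f_t(x)\Big\},\qquad \varphi_{\mathcal{H}}=\inf_{H\in\mathcal{H},\ \mu\in\mathbb{R}_+^H}\Big(f+\sum_{t\in H}\mu_t f_t\Big)^*:X^*\to\overline{\mathbb{R}},$$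 where $h^*(x^*)=\sup_{x\in X}(\langle x^*,x\rangle-h(x))$ is the conjugate of $h$. For a lower semicontinuous proper convex function $h$ on $X$, its recession function $h_\infty$ is the function whose epigraph is the recession cone of the epigraph of $h$. Put $$(\mathrm{P})_\infty=\{x\in X: f_\infty(x)\le 0 \text{ and } (f_t)_\infty(x)\le 0 \text{ for all } t\in T\}.$$ A convex function $g:X^*\to\overline{\mathbb{R}}$ is called $\tau(X^*,X)$-quasicontinuous, where $\tau(X^*,X)$ is the Mackey topology, if the affine hull of $\mathrm{dom}\, g=\{x^*: g(x^*)<+\infty\}$ is $\tau(X^*,X)$-closed and of finite codimension, the $\tau(X^*,X)$-interior $\mathrm{ri}(\mathrm{dom}\, g)$ of $\mathrm{dom}\, g$ relative to this affine hull is nonempty, and the restriction of $g$ to the affine hull is $\tau(X^*,X)$-continuous on $\mathrm{ri}(\mathrm{dom}\, g)$. If $\varphi_{\mathcal{H}}$ is convex and $\tau(X^*,X)$-quasicontinuous and $(\mathrm{P})_\infty$ is a linear subspace of $X$, then $(\mathrm{P})$ has an optimal solution and $$\min(\mathrm{P})=\sup(\mathrm{D}_{\mathcal{H}})\in\mathbb{R}.$$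 Moreover, $\mathrm{sol}(\mathrm{P})$ is the sum of a weakly compact convex subset of $X$ and a finite-dimensional linear subspace of $X$. -/

import Mathlib

open scoped Pointwise NNReal

namespace ConvexInfinite

noncomputable section

/-! ### Extended-real-valued functions -/

/-- The epigraph of `h : E → [-∞, +∞]`, a subset of `E × ℝ`. -/
def epi {E : Type*} (h : E → EReal) : Set (E × ℝ) := {p | h p.1 ≤ (p.2 : EReal)}

/-- The (effective) domain of `h : E → [-∞, +∞]`. -/
def dom {E : Type*} (h : E → EReal) : Set E := {x | h x < ⊤}

/-- `h` is convex: its epigraph is a convex set. -/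
def IsConvexFun {E : Type*} [AddCommGroup E] [Module ℝ E] (h : E → EReal) : Prop :=
  Convex ℝ (epi h)

/-- `h ∈ Γ(X)`: `h` is a lower semicontinuous proper convex function. -/
structure IsGamma {X : Type*} [AddCommGroup X] [Module ℝ X] [TopologicalSpace X]
    (h : X → EReal) : Prop where
  convex : IsConvexFun h
  lsc : LowerSemicontinuous h
  dom_nonempty : (dom h).Nonempty
  ne_bot : ∀ x, h x ≠ ⊥

/-! ### Recession -/

/-- The recession cone `A_∞` of a convex set `A`: the directions in which one can move
indefinitely from any point of `A` without leaving `A`. -/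
def recessionCone {E : Type*} [AddCommGroup E] [Module ℝ E] (A : Set E) : Set E :=
  {d | ∀ a ∈ A, ∀ r : ℝ, 0 ≤ r → a + r • d ∈ A}

/-- The recession function `h_∞` of `h`: the function whose epigraph is the recession cone of the
epigraph of `h` (see `epi_recessionFunction`). -/
def recessionFunction {X : Type*} [AddCommGroup X] [Module ℝ X] (h : X → EReal) (x : X) : EReal :=
  ⨅ (s : ℝ) (_ : (x, s) ∈ recessionCone (epi h)), (s : EReal)

/-- The defining property of the recession function. -/
theorem epi_recessionFunction {X : Type*} [AddCommGroup X] [Module ℝ X] (h : X → EReal) :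
    epi (recessionFunction h) = recessionCone (epi h) := by
  ext ⟨x, s⟩
  constructor
  · intro hs
    rintro ⟨a, α⟩ ha r hr
    have hs' : recessionFunction h x ≤ (s : EReal) := hs
    have ha' : h a ≤ (α : EReal) := ha
    change h (a + r • x) ≤ ((α + r * s : ℝ) : EReal)
    refine EReal.le_of_forall_lt_iff_le.1 fun z hz => ?_
    have hz' : α + r * s < z := by exact_mod_cast hz
    obtain ⟨ε, hε, hεz⟩ : ∃ ε : ℝ, 0 < ε ∧ α + r * (s + ε) ≤ z := by
      refine ⟨(z - (α + r * s)) / (r + 1), by apply div_pos <;> linarith, ?_⟩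
      have h1 : r * ((z - (α + r * s)) / (r + 1)) ≤ z - (α + r * s) := by
        rw [← mul_div_assoc, div_le_iff₀ (by linarith)]
        nlinarith
      linarith
    have hlt : recessionFunction h x < ((s + ε : ℝ) : EReal) :=
      lt_of_le_of_lt hs' (by exact_mod_cast (by linarith : s < s + ε))
    simp only [recessionFunction, iInf_lt_iff] at hlt
    obtain ⟨s', hs'mem, hs'lt⟩ := hlt
    have hs'le : s' < s + ε := by exact_mod_cast hs'lt
    have key : h (a + r • x) ≤ ((α + r * s' : ℝ) : EReal) := hs'mem (a, α) ha' r hr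
    refine key.trans ?_
    have : α + r * s' ≤ z := by nlinarith
    exact_mod_cast this
  · intro hs
    exact iInf₂_le (f := fun (s : ℝ) (_ : (x, s) ∈ recessionCone (epi h)) => (s : EReal)) s hs

/-! ### The dual space with its Mackey topology -/

/-- The topological dual `X*` with the Mackey topology `τ(X*, X)`, i.e. the topology of uniform
convergence on the absolutely convex weakly compact subsets of `X`. -/
abbrev MackeyDual (X : Type*) [AddCommGroup X] [Module ℝ X] [TopologicalSpace X] :=
  UniformConvergenceCLM (RingHom.id ℝ) (E := X) ℝ
    {K : Set X | AbsConvex ℝ K ∧ IsCompact (toWeakSpace ℝ X '' K)}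

/-- The Legendre-Fenchel conjugate `h*(x*) = sup_x (⟨x*, x⟩ - h(x))`. -/
def conj {X : Type*} [AddCommGroup X] [Module ℝ X] [TopologicalSpace X]
    (h : X → EReal) (xs : MackeyDual X) : EReal :=
  ⨆ x : X, ((xs x : ℝ) : EReal) - h x

/-- Quasicontinuity of an extended-real-valued (convex) function `g` on a topological vector
space `E`:
the affine hull of `dom g` is closed and of finite codimension, the interior of `dom g` relative to
its affine hull is nonempty, and the restriction of `g` to the affine hull of `dom g` is continuous
at each point of this relative interior. -/
structure IsQuasicontinuous {E : Type*} [AddCommGroup E] [Module ℝ E] [TopologicalSpace E]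
    (g : E → EReal) : Prop where
  isClosed_aff : IsClosed (affineSpan ℝ (dom g) : Set E)
  finite_codim : FiniteDimensional ℝ (E ⧸ (affineSpan ℝ (dom g)).direction)
  ri_nonempty : (intrinsicInterior ℝ (dom g)).Nonempty
  continuousOn_ri : ∀ x ∈ intrinsicInterior ℝ (dom g),
    ContinuousWithinAt g (affineSpan ℝ (dom g) : Set E) x

/-! ### The optimization problem and its duals

The data are the objective `f` and the constraint functions `c t`, `t ∈ T`, of the problem
`(P)`: minimize `f x` subject to `c t x ≤ 0` for all `t ∈ T`. -/

/-- The feasible set `E` of `(P)`. -/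
def feasibleSet {X T : Type*} (c : T → X → EReal) : Set X := {x | ∀ t, c t x ≤ 0}

/-- The optimal value `inf (P)`. -/
def primalValue {X T : Type*} (f : X → EReal) (c : T → X → EReal) : EReal :=
  ⨅ x ∈ feasibleSet c, f x

/-- The set `sol (P)` of optimal solutions of `(P)`. -/
def solutionSet {X T : Type*} (f : X → EReal) (c : T → X → EReal) : Set X :=
  {x | x ∈ feasibleSet c ∧ ∀ y ∈ feasibleSet c, f x ≤ f y}

/-- The recession cone `(P)_∞` of `(P)`. -/
def problemRecessionCone {X T : Type*} [AddCommGroup X] [Module ℝ X]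
    (f : X → EReal) (c : T → X → EReal) : Set X :=
  {x | (∀ t, recessionFunction (c t) x ≤ 0) ∧ recessionFunction f x ≤ 0}

/-- The function `f + ∑_{t ∈ H} μ_t f_t`. In `EReal` one has `0 * ⊤ = 0`. -/
def lagrangian {X T : Type*} (f : X → EReal) (c : T → X → EReal)
    (H : Finset T) (μ : H → ℝ≥0) (x : X) : EReal :=
  f x + ∑ t : H, ((μ t : ℝ) : EReal) * c t x

/-- `𝓗` is a nonempty family of nonempty finite subsets of `T`, and it covers `T`. -/
structure IsCoveringFamily {T : Type*} (𝓗 : Set (Finset T)) : Prop where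
  nonempty : 𝓗.Nonempty
  nonempty_of_mem : ∀ H ∈ 𝓗, H.Nonempty
  covers : ∀ t : T, ∃ H ∈ 𝓗, t ∈ H

/-- The optimal value `sup (D_𝓗)` of the `𝓗`-dual problem. -/
def dualValue {X T : Type*} (f : X → EReal) (c : T → X → EReal) (𝓗 : Set (Finset T)) : EReal :=
  ⨆ H ∈ 𝓗, ⨆ μ : H → ℝ≥0, ⨅ x : X, lagrangian f c H μ x

/-- The function `φ_𝓗 = inf_{H ∈ 𝓗, μ ∈ ℝ₊^H} (f + ∑_{t ∈ H} μ_t f_t)*` on the dual space. -/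
def phi {X T : Type*} [AddCommGroup X] [Module ℝ X] [TopologicalSpace X]
    (f : X → EReal) (c : T → X → EReal) (𝓗 : Set (Finset T)) (xs : MackeyDual X) : EReal :=
  ⨅ H ∈ 𝓗, ⨅ μ : H → ℝ≥0, conj (lagrangian f c H μ) xs

end

end ConvexInfinite

/-!
Lower semicontinuity makes each Lagrangian its own biconjugate, and the supremum of the Lagrangians
over all multipliers is `f` on the feasible set and `+∞` elsewhere; hence this extended objective is
the conjugate of `φ`. Its minimizers are therefore the points of the subdifferential of `φ` at `0`,
and `-φ 0` is the dual value, so everything follows once this subdifferential is described.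

If `0` were not in the relative interior of `dom φ`, a functional separating it properly would be a
point `d` of `X` by the Mackey–Arens theorem. It would be nonpositive on `dom φ`, that is, a
recession direction of `(P)`, while `-d` would not be one, although `(P)_∞` is a subspace.

So `φ` is continuous at `0` relative to the closed finite-codimensional affine hull of its domain,
and composing it with a continuous linear retraction onto this hull gives a function that is
continuous at `0` on the whole dual. The subdifferential of the latter is nonempty, convex and, by
the bipolar theorem, weakly compact. The two subdifferentials differ by the annihilator of the hull
in `X`, which has finite dimension.
-/

namespace ConvexInfinite

open Filter Topology

section ConvexFunctions

variable {E : Type*} [AddCommGroup E] [Module ℝ E] {g h : E → EReal}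

theorem isConvexFun_iff (hne : ∀ x, h x ≠ ⊥) :
    IsConvexFun h ↔ ∀ ⦃x y : E⦄ ⦃s t : ℝ⦄, 0 < s → 0 < t → s + t = 1 →
      h (s • x + t • y) ≤ s * h x + t * h y := by
  rw [IsConvexFun, convex_iff_forall_pos]
  constructor
  · intro hh x y s t hs ht hst
    by_cases hx : h x = ⊤
    · rw [hx, EReal.coe_mul_top_of_pos hs, EReal.top_add_of_ne_bot]
      · exact le_top
      · simp [EReal.mul_ne_bot, hne y, ht.le]
    by_cases hy : h y = ⊤
    · rw [hy, EReal.coe_mul_top_of_pos ht, EReal.add_top_of_ne_bot]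
      · exact le_top
      · simp [EReal.mul_ne_bot, hne x, hs.le]
    lift h x to ℝ using ⟨hx, hne x⟩ with a ha
    lift h y to ℝ using ⟨hy, hne y⟩ with b hb
    exact hh (x := (x, a)) ha.ge (y := (y, b)) hb.ge hs ht hst
  · rintro hh ⟨x, a⟩ hx ⟨y, b⟩ hy s t hs ht hst
    have hs' : (0 : EReal) ≤ s := EReal.coe_nonneg.2 hs.le
    have ht' : (0 : EReal) ≤ t := EReal.coe_nonneg.2 ht.le
    exact (hh hs ht hst).trans
      (add_le_add (mul_le_mul_of_nonneg_left hx hs') (mul_le_mul_of_nonneg_left hy ht'))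

theorem IsConvexFun.convex_dom (hg : IsConvexFun g) : Convex ℝ (dom g) := by
  have dom_eq : dom g = LinearMap.fst ℝ E ℝ '' epi g := by
    ext x
    constructor
    · intro hx
      obtain ⟨a, ha, -⟩ := EReal.lt_iff_exists_real_btwn.1 hx
      exact ⟨(x, a), ha.le, rfl⟩
    · rintro ⟨p, hp, rfl⟩
      exact hp.trans_lt (EReal.coe_lt_top _)
  rw [dom_eq]
  exact hg.linear_image _

theorem IsConvexFun.comp_affineMap {F : Type*} [AddCommGroup F] [Module ℝ F]
    (hg : IsConvexFun g) (A : F →ᵃ[ℝ] E) : IsConvexFun (g ∘ A) :=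
  Convex.affine_preimage (A.prodMap (AffineMap.id ℝ ℝ)) hg

end ConvexFunctions

section Gamma

variable {X : Type*} [AddCommGroup X] [Module ℝ X] [TopologicalSpace X]

theorem IsGamma.add {h k : X → EReal} (hh : IsGamma h) (hk : IsGamma k) {x₀ : X}
    (hx₀ : x₀ ∈ dom h) (kx₀ : x₀ ∈ dom k) : IsGamma fun x => h x + k x where
  convex := by
    rw [isConvexFun_iff fun x => EReal.add_ne_bot_iff.2 ⟨hh.ne_bot x, hk.ne_bot x⟩]
    intro x y s t hs ht hst
    have distrib : ∀ {r : ℝ}, 0 ≤ r → ∀ z, (r : EReal) * (h z + k z) = r * h z + r * k z :=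
      fun hr z => EReal.left_distrib_of_nonneg_of_ne_top (EReal.coe_nonneg.2 hr)
        (EReal.coe_ne_top _) _ _
    calc h (s • x + t • y) + k (s • x + t • y)
        ≤ (s * h x + t * h y) + (s * k x + t * k y) :=
          add_le_add ((isConvexFun_iff hh.ne_bot).1 hh.convex hs ht hst)
            ((isConvexFun_iff hk.ne_bot).1 hk.convex hs ht hst)
      _ = s * (h x + k x) + t * (h y + k y) := by
          rw [distrib hs.le, distrib ht.le, add_add_add_comm]
  lsc := hh.lsc.add' hk.lsc fun x =>
    EReal.continuousAt_add (Or.inr (hk.ne_bot x)) (Or.inl (hh.ne_bot x))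
  dom_nonempty := ⟨x₀, EReal.add_lt_top hx₀.ne kx₀.ne⟩
  ne_bot x := EReal.add_ne_bot_iff.2 ⟨hh.ne_bot x, hk.ne_bot x⟩

theorem isGamma_zero : IsGamma fun _ : X => (0 : EReal) where
  convex := (isConvexFun_iff fun _ => EReal.zero_ne_bot).2 fun _ _ _ _ _ _ _ => by simp
  lsc := lowerSemicontinuous_const
  dom_nonempty := ⟨0, EReal.zero_lt_top⟩
  ne_bot _ := EReal.zero_ne_bot

theorem IsGamma.const_mul {k : X → EReal} (hk : IsGamma k) (μ : ℝ≥0) :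
    IsGamma fun x => ((μ : ℝ) : EReal) * k x := by
  have hμ : (0 : EReal) ≤ (μ : ℝ) := EReal.coe_nonneg.2 μ.2
  have ne_bot : ∀ x, ((μ : ℝ) : EReal) * k x ≠ ⊥ := fun x => by
    simp [EReal.mul_ne_bot, hk.ne_bot x, hμ]
  refine ⟨(isConvexFun_iff ne_bot).2 fun x y s t hs ht hst => ?_, ?_, ?_, ne_bot⟩
  · calc ((μ : ℝ) : EReal) * k (s • x + t • y)
        ≤ (μ : ℝ) * (s * k x + t * k y) :=
          mul_le_mul_of_nonneg_left ((isConvexFun_iff hk.ne_bot).1 hk.convex hs ht hst) hμ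
      _ = s * ((μ : ℝ) * k x) + t * ((μ : ℝ) * k y) := by
          rw [EReal.left_distrib_of_nonneg_of_ne_top hμ (EReal.coe_ne_top _),
            mul_left_comm, mul_left_comm (t : EReal)]
  · have mul_continuous : Continuous fun u : EReal => ((μ : ℝ) : EReal) * u :=
      continuous_iff_continuousAt.2 fun u => EReal.Tendsto.const_mul tendsto_id
        (Or.inl (EReal.coe_ne_bot _)) (Or.inl (EReal.coe_ne_top _))
    exact mul_continuous.comp_lowerSemicontinuous hk.lsc
      fun _ _ huv => mul_le_mul_of_nonneg_left huv hμ
  · obtain ⟨x, hx : k x < ⊤⟩ := hk.dom_nonempty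
    have mul_ne_top : ((μ : ℝ) : EReal) * k x ≠ ⊤ := by simp [EReal.mul_ne_top, hx.ne, hμ]
    exact ⟨x, mul_ne_top.lt_top⟩

theorem IsGamma.sum {ι : Type*} {k : ι → X → EReal} {x₀ : X} (hk : ∀ i, IsGamma (k i))
    (hx₀ : ∀ i, x₀ ∈ dom (k i)) (S : Finset ι) : IsGamma fun x => ∑ i ∈ S, k i x := by
  classical
  suffices h : IsGamma (fun x => ∑ i ∈ S, k i x) ∧ x₀ ∈ dom fun x => ∑ i ∈ S, k i x from h.1
  induction S using Finset.induction_on with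
  | empty => simpa using ⟨isGamma_zero, EReal.zero_lt_top⟩
  | insert i S hi ih =>
    simp only [Finset.sum_insert hi]
    exact ⟨(hk i).add ih.1 (hx₀ i) ih.2, EReal.add_lt_top (hx₀ i).ne ih.2.ne⟩

end Gamma

section Recession

theorem mem_recessionCone_of_ray {E : Type*} [AddCommGroup E] [Module ℝ E] [TopologicalSpace E]
    [ContinuousAdd E] [ContinuousSMul ℝ E] {C : Set E} (hC : Convex ℝ C)
    (hcl : IsClosed C) {a₀ d : E} (h : ∀ r : ℝ, 0 ≤ r → a₀ + r • d ∈ C) :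
    d ∈ recessionCone C := by
  intro a ha r hr
  -- `a + r • d` is a limit of points on the segments from `a` to points far out on the ray.
  have hmem : ∀ᶠ s in 𝓝[>] (0 : ℝ), (1 - s) • a + s • a₀ + r • d ∈ C := by
    filter_upwards [Ioo_mem_nhdsGT (zero_lt_one' ℝ)] with s hs
    have := hC ha (h (r / s) (div_nonneg hr hs.1.le)) (sub_nonneg.2 hs.2.le) hs.1.le (by ring)
    rwa [smul_add, smul_smul, mul_div_cancel₀ _ hs.1.ne', ← add_assoc] at this
  have hcont : Continuous fun s : ℝ => (1 - s) • a + s • a₀ + r • d := by fun_prop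
  refine hcl.mem_of_tendsto ?_ hmem
  simpa using (hcont.tendsto 0).mono_left nhdsWithin_le_nhds

theorem recessionFunction_nonpos_iff_mem_recessionCone {E : Type*} [AddCommGroup E] [Module ℝ E]
    {h : E → EReal} {d : E} : recessionFunction h d ≤ 0 ↔ (d, (0 : ℝ)) ∈ recessionCone (epi h) := by
  rw [← epi_recessionFunction]
  rfl

theorem recessionFunction_nonpos_iff {E : Type*} [AddCommGroup E] [Module ℝ E]
    {h : E → EReal} {d : E} :
    recessionFunction h d ≤ 0 ↔ ∀ x, ∀ r : ℝ, 0 ≤ r → h (x + r • d) ≤ h x := by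
  rw [recessionFunction_nonpos_iff_mem_recessionCone]
  constructor
  · intro hd x r hr
    refine EReal.le_of_forall_lt_iff_le.1 fun a ha => ?_
    simpa [epi] using hd (x, a) ha.le r hr
  · rintro hd ⟨x, a⟩ ha r hr
    simpa [epi] using (hd x r hr).trans ha

variable {X : Type*} [AddCommGroup X] [Module ℝ X] [TopologicalSpace X]

theorem IsGamma.isClosed_epi {h : X → EReal} (hh : IsGamma h) : IsClosed (epi h) :=
  hh.lsc.isClosed_epigraph.preimage
    (continuous_fst.prodMk (continuous_coe_real_ereal.comp continuous_snd))

theorem IsGamma.recessionFunction_nonpos [ContinuousAdd X] [ContinuousSMul ℝ X]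
    {h : X → EReal} (hh : IsGamma h) {x₀ d : X} {a : ℝ}
    (hr : ∀ r : ℝ, 0 ≤ r → h (x₀ + r • d) ≤ a) : recessionFunction h d ≤ 0 :=
  recessionFunction_nonpos_iff_mem_recessionCone.2 <|
    mem_recessionCone_of_ray hh.convex hh.isClosed_epi (a₀ := (x₀, a)) fun r hr₀ => by
      simpa [epi] using hr r hr₀

end Recession

section Conjugation

variable {X : Type*} [AddCommGroup X] [Module ℝ X] [TopologicalSpace X]

/-- The conjugate `x ↦ sup_{x*} (⟨x*, x⟩ - g(x*))` on `X` of a function `g` on the dual of `X`. -/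
noncomputable def preconj (g : MackeyDual X → EReal) (x : X) : EReal :=
  ⨆ xs : MackeyDual X, ((xs x : ℝ) : EReal) - g xs

theorem coe_sub_le_comm {a : ℝ} {u v : EReal} : (a : EReal) - u ≤ v ↔ (a : EReal) - v ≤ u := by
  induction u with
  | bot => induction v <;> simp [-EReal.coe_sub, ← EReal.coe_sub]
  | top => simp
  | coe p =>
    induction v with
    | bot => simp [← EReal.coe_sub]
    | top => simp
    | coe q =>
      rw [← EReal.coe_sub, ← EReal.coe_sub, EReal.coe_le_coe_iff, EReal.coe_le_coe_iff]
      exact sub_le_comm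

theorem conj_le_coe_iff {h : X → EReal} {xs : MackeyDual X} {s : ℝ} :
    conj h xs ≤ s ↔ ∀ y, ((xs y - s : ℝ) : EReal) ≤ h y := by
  simp only [conj, iSup_le_iff, coe_sub_le_comm, EReal.coe_sub]

theorem preconj_conj_le (h : X → EReal) (x : X) : preconj (conj h) x ≤ h x :=
  iSup_le fun xs => coe_sub_le_comm.1 (le_iSup (fun y => ((xs y : ℝ) : EReal) - h y) x)

theorem preconj_iInf {ι : Sort*} (g : ι → MackeyDual X → EReal) (x : X) :
    preconj (fun xs => ⨅ i, g i xs) x = ⨆ i, preconj (g i) x := by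
  refine eq_of_forall_ge_iff fun v => ?_
  simp only [preconj, iSup_le_iff, coe_sub_le_comm (v := v), le_iInf_iff]
  exact forall_comm

theorem strongDual_prod_apply (G : StrongDual ℝ (X × ℝ)) (x : X) (r : ℝ) :
    G (x, r) = G (x, 0) + r * G (0, 1) := by
  rw [← smul_eq_mul, ← map_smul, ← map_add]
  simp

theorem affine_le_of_forall_sub_mul_le {h : X → EReal} {F : StrongDual ℝ X} {α u : ℝ}
    (hα : 0 < α) (hF : ∀ y, ∀ r : ℝ, h y ≤ r → F y - α * r ≤ u) (y : X) :
    (((α⁻¹ • F) y - α⁻¹ * u : ℝ) : EReal) ≤ h y := by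
  refine EReal.le_of_forall_lt_iff_le.1 fun r hr => EReal.coe_le_coe_iff.2 ?_
  rw [smul_apply, smul_eq_mul, ← mul_sub, inv_mul_le_iff₀ hα]
  linarith [hF y r hr.le]

variable [IsTopologicalAddGroup X] [ContinuousSMul ℝ X] [LocallyConvexSpace ℝ X]

theorem IsGamma.exists_separation {h : X → EReal} (hh : IsGamma h) {x : X} {m : ℝ}
    (hm : m < h x) : ∃ (F : StrongDual ℝ X) (α u : ℝ), 0 ≤ α ∧ u < F x - α * m ∧
      ∀ y, ∀ r : ℝ, h y ≤ r → F y - α * r ≤ u := by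
  obtain ⟨G, u, hG, hu⟩ := geometric_hahn_banach_closed_point (x := (x, m))
    hh.convex hh.isClosed_epi (not_le.2 hm)
  have G_apply : ∀ y r, G (y, r) = (G.comp (.inl ℝ X ℝ)) y - -G (0, 1) * r := fun y r => by
    rw [strongDual_prod_apply, ContinuousLinearMap.comp_apply, ContinuousLinearMap.inl_apply]
    ring
  refine ⟨G.comp (.inl ℝ X ℝ), -G (0, 1), u, ?_, G_apply x m ▸ hu,
    fun y r hr => G_apply y r ▸ (hG (y, r) hr).le⟩
  -- The epigraph contains a vertical half-line, on which `G` is bounded above.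
  obtain ⟨y, hy⟩ := hh.dom_nonempty
  obtain ⟨b, hb, -⟩ := EReal.lt_iff_exists_real_btwn.1 hy
  by_contra! hneg
  have hpos : 0 < G (0, 1) := neg_lt_zero.1 hneg
  have hmem : (y, max b ((u - G (y, 0)) / G (0, 1))) ∈ epi h :=
    hb.le.trans (EReal.coe_le_coe_iff.2 (le_max_left _ _))
  have hlt := hG _ hmem
  rw [strongDual_prod_apply] at hlt
  have hle := mul_le_mul_of_nonneg_right (le_max_right b ((u - G (y, 0)) / G (0, 1))) hpos.le
  rw [div_mul_cancel₀ _ hpos.ne'] at hle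
  linarith

theorem IsGamma.exists_affine_minorant {h : X → EReal} (hh : IsGamma h) :
    ∃ (F : StrongDual ℝ X) (s : ℝ), ∀ y, ((F y - s : ℝ) : EReal) ≤ h y := by
  obtain ⟨x, hx⟩ := hh.dom_nonempty
  lift h x to ℝ using ⟨hx.ne, hh.ne_bot x⟩ with b hb
  obtain ⟨F, α, u, -, hxu, hF⟩ := hh.exists_separation (x := x) (m := b - 1)
    (hb ▸ EReal.coe_lt_coe_iff.2 (sub_one_lt b))
  have hα : 0 < α := by linarith [hF x b hb.ge]
  exact ⟨α⁻¹ • F, α⁻¹ * u, affine_le_of_forall_sub_mul_le hα hF⟩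

theorem IsGamma.exists_affine_minorant_gt {h : X → EReal} (hh : IsGamma h) {x : X} {m : ℝ}
    (hm : m < h x) : ∃ (F : StrongDual ℝ X) (s : ℝ),
      (∀ y, ((F y - s : ℝ) : EReal) ≤ h y) ∧ m < F x - s := by
  obtain ⟨F, α, u, hα, hx, hF⟩ := hh.exists_separation hm
  obtain hα | rfl := hα.lt_or_eq
  · refine ⟨α⁻¹ • F, α⁻¹ * u, affine_le_of_forall_sub_mul_le hα hF, ?_⟩
    rw [smul_apply, smul_eq_mul, ← mul_sub, lt_inv_mul_iff₀ hα]
    linarith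
  -- The separating hyperplane is vertical: adding a large multiple of `F - u`, which is
  -- nonpositive on `dom h` and positive at `x`, to any affine minorant lifts it above `m` at `x`.
  simp only [zero_mul, sub_zero] at hx hF
  obtain ⟨G, s, hG⟩ := hh.exists_affine_minorant
  have hpos : 0 < F x - u := sub_pos.2 hx
  obtain ⟨k, hk⟩ := exists_nat_gt ((m - (G x - s)) / (F x - u))
  refine ⟨G + (k : ℝ) • F, s + k * u, fun y => ?_, ?_⟩
  · refine EReal.le_of_forall_lt_iff_le.1 fun r hr => EReal.coe_le_coe_iff.2 ?_
    have hGr : G y - s ≤ r := EReal.coe_le_coe_iff.1 ((hG y).trans hr.le)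
    have hFu : (k : ℝ) * F y ≤ k * u := mul_le_mul_of_nonneg_left (hF y r hr.le) k.cast_nonneg
    rw [add_apply, smul_apply, smul_eq_mul]
    linarith
  · rw [div_lt_iff₀ hpos] at hk
    rw [add_apply, smul_apply, smul_eq_mul]
    linarith

theorem IsGamma.preconj_conj {h : X → EReal} (hh : IsGamma h) : preconj (conj h) = h := by
  funext x
  refine le_antisymm (preconj_conj_le h x) (EReal.ge_of_forall_gt_iff_ge.1 fun m hm => ?_)
  obtain ⟨F, s, hF, hlt⟩ := hh.exists_affine_minorant_gt hm
  let xs : MackeyDual X := F.toUniformConvergenceCLM (RingHom.id ℝ) ℝ _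
  have hconj : conj h xs ≤ s := conj_le_coe_iff.2 hF
  calc (m : EReal) ≤ ((xs x : ℝ) : EReal) - s := by
        rw [← EReal.coe_sub]
        exact EReal.coe_le_coe_iff.2 hlt.le
    _ ≤ ((xs x : ℝ) : EReal) - conj h xs := EReal.sub_le_sub le_rfl hconj
    _ ≤ preconj (conj h) x := le_iSup (fun xs : MackeyDual X => ((xs x : ℝ) : EReal) - conj h xs) xs

end Conjugation

section Separation

variable {E : Type*} [AddCommGroup E] [Module ℝ E] [TopologicalSpace E]

theorem lt_of_mem_interior_of_forall_le [ContinuousAdd E] [ContinuousSMul ℝ E]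
    {F : StrongDual ℝ E} (hF : F ≠ 0) {C : Set E} {u : ℝ} (hC : ∀ a ∈ C, F a ≤ u) {z : E}
    (hz : z ∈ interior C) : F z < u := by
  have image_subset : F '' interior C ⊆ interior (Set.Iic u) :=
    interior_maximal (Set.image_subset_iff.2 fun a ha => hC a (interior_subset ha))
      (F.isOpenMap_of_ne_zero hF _ isOpen_interior)
  simpa using image_subset ⟨z, hz, rfl⟩

theorem mem_intrinsicInterior_iff_nhdsWithin {C : Set E} {z : E} :
    z ∈ intrinsicInterior ℝ C ↔
      z ∈ affineSpan ℝ C ∧ C ∈ 𝓝[(affineSpan ℝ C : Set E)] z := by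
  rw [mem_intrinsicInterior]
  constructor
  · rintro ⟨y, hy, rfl⟩
    exact ⟨y.2, preimage_coe_mem_nhds_subtype.1 (mem_interior_iff_mem_nhds.1 hy)⟩
  · rintro ⟨hz, hC⟩
    exact ⟨⟨z, hz⟩, mem_interior_iff_mem_nhds.2 (preimage_coe_mem_nhds_subtype.2 hC), rfl⟩

theorem map_add_nhds_direction [IsTopologicalAddGroup E] {S : AffineSubspace ℝ E} {z : E}
    (hz : z ∈ S) (m : S.direction) :
    map (fun n : S.direction => z + n) (𝓝 m) = 𝓝[(S : Set E)] (z + m) := by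
  have range_eq : Set.range (fun n : S.direction => z + (n : E)) = S := by
    ext y
    constructor
    · rintro ⟨n, rfl⟩
      simpa [add_comm z] using AffineSubspace.vadd_mem_of_mem_direction n.2 hz
    · exact fun hy => ⟨⟨y - z, S.vsub_mem_direction hy hz⟩, add_sub_cancel z y⟩
  have inducing : IsInducing fun n : S.direction => z + (n : E) :=
    (Homeomorph.addLeft z).isInducing.comp IsInducing.subtypeVal
  rw [inducing.map_nhds_eq, range_eq]

theorem add_mem_intrinsicInterior_iff [IsTopologicalAddGroup E] {C : Set E} {z : E}
    (hz : z ∈ affineSpan ℝ C) (m : (affineSpan ℝ C).direction) :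
    z + (m : E) ∈ intrinsicInterior ℝ C ↔
      m ∈ interior {n : (affineSpan ℝ C).direction | z + (n : E) ∈ C} := by
  have hm : z + (m : E) ∈ affineSpan ℝ C :=
    add_comm (m : E) z ▸ AffineSubspace.vadd_mem_of_mem_direction m.2 hz
  rw [mem_intrinsicInterior_iff_nhdsWithin, and_iff_right hm, mem_interior_iff_mem_nhds,
    ← map_add_nhds_direction hz]
  rfl

variable [IsTopologicalAddGroup E] [ContinuousSMul ℝ E]

theorem exists_forall_le_and_exists_lt_of_notMem_intrinsicInterior [LocallyConvexSpace ℝ E]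
    {C : Set E} (hC : Convex ℝ C) (hcl : IsClosed (affineSpan ℝ C : Set E))
    (hri : (intrinsicInterior ℝ C).Nonempty) {z : E} (hz : z ∉ intrinsicInterior ℝ C) :
    ∃ F : StrongDual ℝ E, (∀ c ∈ C, F c ≤ F z) ∧ ∃ c ∈ C, F c < F z := by
  obtain ⟨w, hw⟩ := hri
  have hwC : w ∈ C := intrinsicInterior_subset hw
  by_cases hzS : z ∈ affineSpan ℝ C
  · set M := (affineSpan ℝ C).direction
    have sub_mem : ∀ {c}, c ∈ C → c - z ∈ M := fun hc =>
      AffineSubspace.vsub_mem_direction (subset_affineSpan ℝ C hc) hzS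
    set D : Set M := {n | z + (n : E) ∈ C} with hD
    have D_convex : Convex ℝ D := (hC.translate_preimage_right z).linear_preimage M.subtype
    have zero_notMem : (0 : M) ∉ interior D := by
      rw [← add_mem_intrinsicInterior_iff hzS]
      simpa using hz
    have sub_mem_interior : (⟨w - z, sub_mem hwC⟩ : M) ∈ interior D := by
      rw [← add_mem_intrinsicInterior_iff hzS]
      simpa using hw
    obtain ⟨F, hF, hle⟩ := geometric_hahn_banach_of_nonempty_interior_point D_convex zero_notMem
      ⟨_, sub_mem_interior⟩
    have hlt := lt_of_mem_interior_of_forall_le hF hle sub_mem_interior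
    obtain ⟨G, hG⟩ := StrongDual.exists_extension M F
    have G_sub : ∀ c (hc : c ∈ C), G c - G z = F ⟨c - z, sub_mem hc⟩ := fun c hc => by
      rw [← map_sub]
      exact hG ⟨c - z, sub_mem hc⟩
    rw [map_zero] at hle hlt
    refine ⟨G, fun c hc => sub_nonpos.1 ?_, w, hwC, sub_neg.1 ?_⟩
    · exact G_sub c hc ▸ hle _ (by simpa [hD] using hc)
    · exact G_sub w hwC ▸ hlt
  · obtain ⟨F, u, hF, hu⟩ := geometric_hahn_banach_closed_point (affineSpan ℝ C).convex hcl hzS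
    have hlt : ∀ c ∈ C, F c < F z := fun c hc => (hF c (subset_affineSpan ℝ C hc)).trans hu
    exact ⟨F, fun c hc => (hlt c hc).le, w, hwC, hlt w hwC⟩

end Separation

section Subgradient

variable {E : Type*} [TopologicalSpace E] {g : E → EReal} {z : E}

theorem mem_interior_epi_of_lt {r : ℝ} (hg : ContinuousAt g z) (hr : g z < r) :
    (z, r) ∈ interior (epi g) := by
  have tendsto_fst : Tendsto (fun p : E × ℝ => g p.1) (𝓝 (z, r)) (𝓝 (g z)) :=
    ContinuousAt.comp (x := (z, r)) hg continuousAt_fst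
  have tendsto_snd : Tendsto (fun p : E × ℝ => (p.2 : EReal)) (𝓝 (z, r)) (𝓝 r) :=
    (continuous_coe_real_ereal.comp continuous_snd).continuousAt
  rw [mem_interior_iff_mem_nhds]
  filter_upwards [tendsto_fst.eventually_lt tendsto_snd hr] with p hp using hp.le

theorem lt_of_mem_interior_epi {r : ℝ} (h : (z, r) ∈ interior (epi g)) : g z < r := by
  have hev : ∀ᶠ s : ℝ in 𝓝 r, g z ≤ s :=
    (Continuous.prodMk_right z).continuousAt.eventually (mem_interior_iff_mem_nhds.1 h)
  obtain ⟨s, hs, hsr⟩ := ((hev.filter_mono nhdsWithin_le_nhds).and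
    (self_mem_nhdsWithin : Set.Iio r ∈ 𝓝[<] r)).exists
  exact hs.trans_lt (EReal.coe_lt_coe_iff.2 hsr)

theorem IsConvexFun.exists_subgradient [AddCommGroup E] [Module ℝ E] [IsTopologicalAddGroup E]
    [ContinuousSMul ℝ E] (hg : IsConvexFun g) (hcont : ContinuousAt g z) {v : ℝ} (hv : g z = v) :
    ∃ F : StrongDual ℝ E, ∀ y, g z + ((F (y - z) : ℝ) : EReal) ≤ g y := by
  have mem_interior : (z, v + 1) ∈ interior (epi g) :=
    mem_interior_epi_of_lt hcont (hv ▸ EReal.coe_lt_coe_iff.2 (lt_add_one v))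
  have notMem_interior : (z, v) ∉ interior (epi g) := fun h =>
    (lt_of_mem_interior_epi h).ne hv
  obtain ⟨G, hG, hle⟩ := geometric_hahn_banach_of_nonempty_interior_point hg notMem_interior
    ⟨_, mem_interior⟩
  have hα : 0 < -G (0, 1) := by
    have hlt := lt_of_mem_interior_of_forall_le hG hle mem_interior
    rw [strongDual_prod_apply, strongDual_prod_apply G z v] at hlt
    linarith
  refine ⟨(-G (0, 1))⁻¹ • G.comp (.inl ℝ E ℝ), fun y => ?_⟩
  rw [hv, ← EReal.coe_add]
  refine EReal.le_of_forall_lt_iff_le.1 fun r hr => EReal.coe_le_coe_iff.2 ?_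
  have hyr := hle (y, r) hr.le
  rw [strongDual_prod_apply, strongDual_prod_apply G z v] at hyr
  have hsub : G (y - z, 0) = G (y, 0) - G (z, 0) := by rw [← map_sub]; simp
  rw [smul_apply, smul_eq_mul, ContinuousLinearMap.comp_apply, ContinuousLinearMap.inl_apply,
    ← le_sub_iff_add_le', inv_mul_le_iff₀ hα, hsub]
  linarith

end Subgradient

section Mackey

theorem exists_mem_eq_of_le_one_on_polar {W Y : Type*} [AddCommGroup W] [Module ℝ W]
    [TopologicalSpace W] [AddCommGroup Y] [Module ℝ Y] {B : W →ₗ[ℝ] Y →ₗ[ℝ] ℝ}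
    (hB : ∀ y, Continuous fun w => B w y) {K : Set W} (hK : AbsConvex ℝ K) (hKc : IsCompact K)
    (hne : K.Nonempty) {F : Module.Dual ℝ Y} (hF : ∀ y ∈ B.polar K, F y ≤ 1) :
    ∃ k ∈ K, B k = F := by
  let D : Module.Dual ℝ Y →ₗ[ℝ] Y →ₗ[ℝ] ℝ := LinearMap.id
  have : T2Space (WeakBilin D) := (WeakBilin.isEmbedding Function.injective_id).t2Space
  let e : W →ₗ[ℝ] WeakBilin D := B
  have e_continuous : Continuous e := WeakBilin.continuous_of_continuous_eval D hB
  by_contra hcon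
  have notMem_image : (F : WeakBilin D) ∉ e '' K := hcon
  obtain ⟨ℓ, u, hℓ, hu⟩ := geometric_hahn_banach_closed_point (hK.2.linear_image e)
    (hKc.image e_continuous).isClosed notMem_image
  obtain ⟨y, rfl⟩ := LinearMap.dualEmbedding_surjective D ℓ
  have hlt : ∀ k ∈ K, B k y < u := fun k hk => hℓ _ ⟨k, hk, rfl⟩
  have hFy : u < F y := hu
  have hu₀ : 0 < u := by simpa using hlt 0 (hK.1.zero_mem hne)
  have mem_polar : u⁻¹ • y ∈ B.polar K := fun k hk => by
    have hneg := hlt (-k) (hK.1.neg_mem_iff.2 hk)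
    rw [map_neg, LinearMap.neg_apply] at hneg
    rw [map_smul, smul_eq_mul, norm_mul, Real.norm_of_nonneg (inv_pos.2 hu₀).le,
      inv_mul_le_iff₀ hu₀, mul_one, Real.norm_eq_abs]
    exact abs_le.2 ⟨by linarith, (hlt k hk).le⟩
  have hle := hF _ mem_polar
  rw [map_smul, smul_eq_mul, inv_mul_le_iff₀ hu₀] at hle
  linarith

variable (X : Type*) [AddCommGroup X] [Module ℝ X] [TopologicalSpace X]

/-- The sets whose polars form a neighbourhood base at `0` for the Mackey topology. -/
abbrev mackeySets : Set (Set X) := {K | AbsConvex ℝ K ∧ IsCompact (toWeakSpace ℝ X '' K)}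

theorem mackeySets_nonempty : (mackeySets X).Nonempty :=
  ⟨∅, ⟨balanced_empty, convex_empty⟩, by simp⟩

theorem mackeySets_directedOn : DirectedOn (· ⊆ ·) (mackeySets X) := by
  rintro K ⟨hK, hKc⟩ L ⟨hL, hLc⟩
  obtain rfl | hKne := K.eq_empty_or_nonempty
  · exact ⟨L, ⟨hL, hLc⟩, Set.empty_subset _, subset_rfl⟩
  obtain rfl | hLne := L.eq_empty_or_nonempty
  · exact ⟨K, ⟨hK, hKc⟩, subset_rfl, Set.empty_subset _⟩
  refine ⟨K + L, ⟨⟨hK.1.add hL.1, hK.2.add hL.2⟩, ?_⟩,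
    Set.subset_add_left _ (hL.1.zero_mem hLne), Set.subset_add_right _ (hK.1.zero_mem hKne)⟩
  rw [Set.image_add]
  exact hKc.add hLc

/-- The evaluation pairing of `X` with its Mackey dual, as a map into the algebraic bidual. -/
noncomputable def evalMackey : X →ₗ[ℝ] MackeyDual X →ₗ[ℝ] ℝ :=
  LinearMap.mk₂ ℝ (fun x xs => xs x) (fun x y xs => map_add xs x y) (fun r x xs => map_smul xs r x)
    (fun _ _ _ => rfl) fun _ _ _ => rfl

@[simp]
theorem evalMackey_apply (x : X) (xs : MackeyDual X) : evalMackey X x xs = xs x := rfl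

theorem evalMackey_injective [IsTopologicalAddGroup X] [ContinuousSMul ℝ X]
    [LocallyConvexSpace ℝ X] [T2Space X] : Function.Injective (evalMackey X) := fun _ _ hxy =>
  SeparatingDual.eq_iff_forall_dual_eq.2 fun F =>
    LinearMap.congr_fun hxy (F.toUniformConvergenceCLM (RingHom.id ℝ) ℝ _)

variable {X}

theorem continuous_eval_weakSpace (xs : MackeyDual X) :
    Continuous fun w : WeakSpace ℝ X => xs ((toWeakSpace ℝ X).symm w) :=
  WeakBilin.eval_continuous (topDualPairing ℝ X).flip
    ((ContinuousLinearMap.toUniformConvergenceCLM _ _ _).symm xs)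

theorem exists_mem_evalMackey_eq {K : Set X} (hK : K ∈ mackeySets X) (hne : K.Nonempty)
    {F : Module.Dual ℝ (MackeyDual X)} (hF : ∀ xs ∈ (evalMackey X).polar K, F xs ≤ 1) :
    ∃ k ∈ K, evalMackey X k = F := by
  have balanced_image : Balanced ℝ (toWeakSpace ℝ X '' K) := fun a ha => by
    rw [← image_smul_set]
    exact Set.image_mono (hK.1.1 a ha)
  obtain ⟨_, ⟨k, hk, rfl⟩, hkF⟩ := exists_mem_eq_of_le_one_on_polar
    (B := evalMackey X ∘ₗ (toWeakSpace ℝ X).symm.toLinearMap) (K := toWeakSpace ℝ X '' K) (F := F)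
    continuous_eval_weakSpace
    ⟨balanced_image, hK.1.2.linear_image (toWeakSpace ℝ X).toLinearMap⟩
    hK.2 (hne.image _) fun xs hxs => hF xs fun k hk => hxs _ ⟨k, hk, rfl⟩
  exact ⟨k, hk, hkF⟩

instance : LocallyConvexSpace ℝ (MackeyDual X) :=
  UniformConvergenceCLM.locallyConvexSpace ℝ _ (mackeySets_nonempty X) (mackeySets_directedOn X)

instance : ContinuousSMul ℝ (MackeyDual X) := by
  let φ : MackeyDual X →ₗ[ℝ] X → ℝ := ⟨⟨DFunLike.coe, fun _ _ => rfl⟩, fun _ _ => rfl⟩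
  refine UniformOnFun.continuousSMul_induced_of_image_bounded ℝ X ℝ (MackeyDual X) φ
    (UniformConvergenceCLM.isEmbedding_coeFn (RingHom.id ℝ) ℝ _).isInducing fun xs K hK => ?_
  have image_compact : IsCompact (xs '' K) := by
    simpa only [Set.image_image, LinearEquiv.symm_apply_apply]
      using hK.2.image (continuous_eval_weakSpace xs)
  exact image_compact.isVonNBounded ℝ

theorem exists_polar_subset {U : Set (MackeyDual X)} (hU : U ∈ 𝓝 0) :
    ∃ K ∈ mackeySets X, K.Nonempty ∧ (evalMackey X).polar K ⊆ U := by
  obtain ⟨⟨K, ε⟩, ⟨⟨hK, hKc⟩, hε⟩, hKU⟩ := (UniformConvergenceCLM.hasBasis_nhds_zero_of_basis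
    (RingHom.id ℝ) ℝ _ (mackeySets_nonempty X) (mackeySets_directedOn X)
    Metric.nhds_basis_ball).mem_iff.1 hU
  dsimp only at hK hKc hε hKU
  obtain rfl | hne := K.eq_empty_or_nonempty
  · exact ⟨{0}, ⟨⟨balanced_zero, convex_singleton 0⟩, by simp⟩, by simp,
      fun xs _ => hKU (by simp)⟩
  refine ⟨(2 / ε) • K, ⟨⟨hK.1.smul _, hK.2.smul _⟩, ?_⟩, hne.smul_set,
    fun xs hxs => hKU fun k hk => ?_⟩
  · rw [image_smul_set]
    exact hKc.smul (2 / ε)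
  · have hle := hxs _ (Set.smul_mem_smul_set hk)
    rw [evalMackey_apply, map_smul, norm_smul, Real.norm_of_nonneg (by positivity),
      div_mul_eq_mul_div, div_le_one hε] at hle
    rw [mem_ball_zero_iff]
    linarith [norm_nonneg (xs k)]

theorem exists_evalMackey_eq (F : StrongDual ℝ (MackeyDual X)) :
    ∃ x : X, evalMackey X x = F.toLinearMap := by
  have hU : F ⁻¹' Set.Iio 1 ∈ 𝓝 0 :=
    F.continuous.continuousAt.preimage_mem_nhds (by simpa using Iio_mem_nhds (zero_lt_one' ℝ))
  obtain ⟨K, hK, hne, hKU⟩ := exists_polar_subset hU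
  obtain ⟨k, -, hk⟩ := exists_mem_evalMackey_eq (F := F.toLinearMap) hK hne
    fun xs hxs => (show F xs < 1 from hKU hxs).le
  exact ⟨k, hk⟩

/-- The annihilator in `X` of a subspace of the dual of `X`. -/
noncomputable def preannihilator (M : Submodule ℝ (MackeyDual X)) : Submodule ℝ X :=
  M.dualAnnihilator.comap (evalMackey X)

theorem mem_preannihilator {M : Submodule ℝ (MackeyDual X)} {x : X} :
    x ∈ preannihilator M ↔ ∀ xs ∈ M, xs x = 0 :=
  Submodule.mem_dualAnnihilator _

instance [IsTopologicalAddGroup X] [ContinuousSMul ℝ X] [LocallyConvexSpace ℝ X] [T2Space X]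
    (M : Submodule ℝ (MackeyDual X)) [FiniteDimensional ℝ (MackeyDual X ⧸ M)] :
    FiniteDimensional ℝ (preannihilator M) := by
  let restrict : preannihilator M →ₗ[ℝ] Module.Dual ℝ (MackeyDual X ⧸ M) :=
    M.dualQuotEquivDualAnnihilator.symm.toLinearMap ∘ₗ
      (evalMackey X).submoduleComap M.dualAnnihilator
  have restrict_injective : Function.Injective restrict :=
    M.dualQuotEquivDualAnnihilator.symm.injective.comp fun x y hxy =>
      Subtype.ext (evalMackey_injective X (congrArg Subtype.val hxy))
  exact FiniteDimensional.of_injective restrict restrict_injective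

end Mackey

section Subdifferential

variable {X : Type*} [AddCommGroup X] [Module ℝ X] [TopologicalSpace X]
  {g : MackeyDual X → EReal} {z : MackeyDual X}

/-- The subdifferential at `z` of a function on the dual of `X`, consisting of the subgradients
that are represented by points of `X`. -/
def subdifferential (g : MackeyDual X → EReal) (z : MackeyDual X) : Set X :=
  {x | ∀ y, g z + (((y - z) x : ℝ) : EReal) ≤ g y}

theorem convex_subdifferential : Convex ℝ (subdifferential g z) := by
  rw [subdifferential, Set.ofPred_forall]
  refine convex_iInter fun y => ?_
  have isLowerSet : IsLowerSet {t : ℝ | g z + (t : EReal) ≤ g y} := fun s t hts hs =>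
    (add_le_add_right (EReal.coe_le_coe_iff.2 hts) (g z)).trans hs
  exact isLowerSet.ordConnected.convex.linear_preimage ((evalMackey X).flip (y - z))

theorem isClosed_toWeakSpace_image_subdifferential :
    IsClosed (toWeakSpace ℝ X '' subdifferential g z) := by
  rw [LinearEquiv.image_eq_preimage_symm, subdifferential, Set.ofPred_forall, Set.preimage_iInter]
  refine isClosed_iInter fun y => ?_
  have continuous_add : Continuous fun t : ℝ => g z + (t : EReal) :=
    continuous_iff_continuousAt.2 fun t => ContinuousAt.comp (x := t)
      (f := fun t : ℝ => (g z, (t : EReal)))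
      (EReal.continuousAt_add (Or.inr (EReal.coe_ne_bot t)) (Or.inr (EReal.coe_ne_top t)))
      (continuous_const.prodMk continuous_coe_real_ereal).continuousAt
  exact isClosed_Iic.preimage (continuous_add.comp (continuous_eval_weakSpace (y - z)))

theorem exists_mackeySets_forall_subgradient (hcont : ContinuousAt g z) {v : ℝ} (hv : g z = v) :
    ∃ K ∈ mackeySets X, ∀ F : Module.Dual ℝ (MackeyDual X),
      (∀ y, g z + ((F (y - z) : ℝ) : EReal) ≤ g y) → ∃ k ∈ K, evalMackey X k = F := by
  have hlt : {y | g (z + y) < ((v + 1 : ℝ) : EReal)} ∈ 𝓝 0 := by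
    have hcont₀ : ContinuousAt (fun y => g (z + y)) 0 :=
      ContinuousAt.comp (by rwa [add_zero]) (continuous_const_add z).continuousAt
    refine hcont₀.eventually_lt_const ?_
    simp only [add_zero, hv]
    exact EReal.coe_lt_coe_iff.2 (lt_add_one v)
  obtain ⟨K, hK, hne, hKsub⟩ := exists_polar_subset hlt
  refine ⟨K, hK, fun F hF => exists_mem_evalMackey_eq hK hne fun y hy => ?_⟩
  have hle := (hF (z + y)).trans (hKsub hy).le
  rw [hv, add_sub_cancel_left, ← EReal.coe_add, EReal.coe_le_coe_iff] at hle
  linarith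

theorem IsConvexFun.nonempty_subdifferential (hg : IsConvexFun g) (hcont : ContinuousAt g z)
    {v : ℝ} (hv : g z = v) : (subdifferential g z).Nonempty := by
  obtain ⟨F, hF⟩ := hg.exists_subgradient hcont hv
  obtain ⟨x, hx⟩ := exists_evalMackey_eq F
  refine ⟨x, fun y => ?_⟩
  rw [← evalMackey_apply, hx]
  exact hF y

theorem subdifferential_eq_add {M : Submodule ℝ (MackeyDual X)} {r : MackeyDual X →ₗ[ℝ] M}
    (hr : ∀ m : M, r m = m) (hM : ∀ y ∈ dom g, y - z ∈ M)
    (hcont : ContinuousAt (fun y => g (z + r y)) 0) {v : ℝ} (hv : g z = v) :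
    subdifferential g z =
      subdifferential (fun y => g (z + r y)) 0 + (preannihilator M : Set X) := by
  have g_retract : ∀ y ∈ dom g, g (z + r (y - z)) = g y := fun y hy => by
    rw [hr ⟨y - z, hM y hy⟩, add_sub_cancel]
  have g_retract_zero : g (z + r 0) = g z := by rw [map_zero, Submodule.coe_zero, add_zero]
  ext x
  constructor
  · intro hx
    obtain ⟨K, -, hK⟩ := exists_mackeySets_forall_subgradient hcont (g_retract_zero.trans hv)
    have subgradient : ∀ y : MackeyDual X,
        g z + (((r y : MackeyDual X) x : ℝ) : EReal) ≤ g (z + r y) := fun y => by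
      simpa only [add_sub_cancel_left] using hx (z + r y)
    -- The functional `y ↦ (r y) x` need not be continuous a priori, but it is a subgradient at a
    -- point of continuity, so the bipolar theorem represents it by a point `k` of `X`.
    obtain ⟨k, -, hk⟩ := hK (evalMackey X x ∘ₗ M.subtype ∘ₗ r) fun y => by
      rw [g_retract_zero, sub_zero]
      exact subgradient y
    have apply_k : ∀ y : MackeyDual X, y k = (r y : MackeyDual X) x := LinearMap.congr_fun hk
    refine ⟨k, fun y => ?_, x - k, mem_preannihilator.2 fun y hy => ?_, add_sub_cancel k x⟩
    · simpa only [g_retract_zero, sub_zero, apply_k] using subgradient y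
    · rw [map_sub, apply_k, hr ⟨y, hy⟩, sub_self]
  · rintro ⟨k, hk, d, hd, rfl⟩ y
    obtain hy | hy := eq_or_ne (g y) ⊤
    · exact hy ▸ le_top
    have hy' : y ∈ dom g := hy.lt_top
    have hky := hk (y - z)
    simp only [g_retract_zero, sub_zero, g_retract y hy'] at hky
    rwa [map_add, mem_preannihilator.1 hd _ (hM y hy'), add_zero]

variable [IsTopologicalAddGroup X] [ContinuousSMul ℝ X] [LocallyConvexSpace ℝ X] [T2Space X]

theorem isCompact_toWeakSpace_image_subdifferential (hcont : ContinuousAt g z) {v : ℝ}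
    (hv : g z = v) : IsCompact (toWeakSpace ℝ X '' subdifferential g z) := by
  obtain ⟨K, hK, hF⟩ := exists_mackeySets_forall_subgradient hcont hv
  refine hK.2.of_isClosed_subset isClosed_toWeakSpace_image_subdifferential
    (Set.image_mono fun x hx => ?_)
  obtain ⟨k, hk, hkx⟩ := hF (evalMackey X x) hx
  exact evalMackey_injective X hkx ▸ hk

theorem IsQuasicontinuous.exists_subdifferential_eq_add (hq : IsQuasicontinuous g)
    (hg : IsConvexFun g) (hz : z ∈ intrinsicInterior ℝ (dom g)) {v : ℝ} (hv : g z = v) :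
    ∃ (C : Set X) (V : Submodule ℝ X), C.Nonempty ∧ Convex ℝ C ∧
      IsCompact (toWeakSpace ℝ X '' C) ∧ FiniteDimensional ℝ V ∧
      subdifferential g z = C + (V : Set X) := by
  let S := affineSpan ℝ (dom g)
  have hzS : z ∈ S := subset_affineSpan ℝ _ (intrinsicInterior_subset hz)
  have vadd_mem : ∀ y : MackeyDual X, y + z ∈ S ↔ y ∈ S.direction := fun y =>
    AffineSubspace.vadd_mem_iff_mem_direction y hzS
  have isClosed_direction : IsClosed (S.direction : Set (MackeyDual X)) := by
    have preimage_eq : (· + z) ⁻¹' (S : Set (MackeyDual X)) = S.direction := Set.ext vadd_mem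
    exact preimage_eq ▸ hq.isClosed_aff.preimage (continuous_add_const z)
  have := hq.finite_codim
  obtain ⟨r, hr⟩ := Submodule.ClosedComplemented.of_finiteDimensional_quotient isClosed_direction
  have sub_mem : ∀ y ∈ dom g, y - z ∈ S.direction := fun y hy =>
    AffineSubspace.vsub_mem_direction (subset_affineSpan ℝ _ hy) hzS
  have retract_zero : z + (r 0 : MackeyDual X) = z := by simp
  have hcont : ContinuousAt (fun y => g (z + r y)) 0 := by
    have continuous_retract : Continuous fun y => z + (r y : MackeyDual X) := by fun_prop
    have tendsto_retract : Tendsto (fun y => z + (r y : MackeyDual X)) (𝓝 0)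
        (𝓝[(S : Set (MackeyDual X))] z) :=
      tendsto_nhdsWithin_iff.2 ⟨continuous_retract.tendsto' 0 z retract_zero,
        .of_forall fun y => add_comm z _ ▸ (vadd_mem _).2 (r y).2⟩
    rw [ContinuousAt]
    simp only [retract_zero]
    exact (hq.continuousOn_ri z hz).tendsto.comp tendsto_retract
  have hconv : IsConvexFun fun y => g (z + r y) :=
    hg.comp_affineMap (AffineMap.const ℝ _ z + (S.direction.subtype ∘ₗ r.toLinearMap).toAffineMap)
  have hv₀ : g (z + r 0) = v := retract_zero.symm ▸ hv
  exact ⟨_, preannihilator S.direction, hconv.nonempty_subdifferential hcont hv₀,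
    convex_subdifferential, isCompact_toWeakSpace_image_subdifferential hcont hv₀, inferInstance,
    subdifferential_eq_add (r := r.toLinearMap) hr sub_mem hcont hv⟩

end Subdifferential

section ConjugateDuality

variable {X : Type*} [AddCommGroup X] [Module ℝ X] [TopologicalSpace X]
  {g : MackeyDual X → EReal}

theorem mem_subdifferential_zero_iff {v : ℝ} (hv : g 0 = v) {x : X} :
    x ∈ subdifferential g 0 ↔ preconj g x ≤ ((-v : ℝ) : EReal) := by
  simp only [subdifferential, Set.mem_ofPred_eq, preconj, iSup_le_iff]
  refine forall_congr' fun xs => ?_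
  rw [coe_sub_le_comm, ← EReal.coe_sub, sub_neg_eq_add, hv, sub_zero, ← EReal.coe_add, add_comm v]

theorem recessionFunction_preconj_nonpos_iff {x₀ : X} (hx₀ : x₀ ∈ dom (preconj g)) {d : X} :
    recessionFunction (preconj g) d ≤ 0 ↔ ∀ xs ∈ dom g, xs d ≤ 0 := by
  rw [recessionFunction_nonpos_iff]
  constructor
  · intro hd xs hxs
    obtain ⟨a, ha, -⟩ := EReal.lt_iff_exists_real_btwn.1 (show preconj g x₀ < ⊤ from hx₀)
    obtain ⟨s, hs, -⟩ := EReal.lt_iff_exists_real_btwn.1 (show g xs < ⊤ from hxs)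
    have bounded : ∀ r : ℝ, 0 ≤ r → xs x₀ + r * xs d - s ≤ a := fun r hr => by
      rw [← EReal.coe_le_coe_iff, EReal.coe_sub, ← smul_eq_mul, ← map_smul, ← map_add]
      calc ((xs (x₀ + r • d) : ℝ) : EReal) - s
          ≤ ((xs (x₀ + r • d) : ℝ) : EReal) - g xs := EReal.sub_le_sub le_rfl hs.le
        _ ≤ preconj g (x₀ + r • d) := le_iSup (fun ys => ((ys _ : ℝ) : EReal) - g ys) xs
        _ ≤ a := (hd x₀ r hr).trans ha.le
    by_contra! hpos
    have hle := bounded 0 le_rfl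
    have hlt := bounded ((a + s - xs x₀ + 1) / xs d) (div_nonneg (by linarith) hpos.le)
    rw [div_mul_cancel₀ _ hpos.ne'] at hlt
    linarith
  · intro hd x r hr
    refine iSup_le fun xs => ?_
    obtain hxs | hxs := eq_or_ne (g xs) ⊤
    · simp [hxs]
    have apply_le : xs (x + r • d) ≤ xs x := by
      rw [map_add, map_smul, smul_eq_mul]
      linarith [mul_nonpos_of_nonneg_of_nonpos hr (hd xs hxs.lt_top)]
    exact (EReal.sub_le_sub (EReal.coe_le_coe_iff.2 apply_le) le_rfl).trans
      (le_iSup (fun ys => ((ys x : ℝ) : EReal) - g ys) xs)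

theorem IsQuasicontinuous.zero_mem_intrinsicInterior (hq : IsQuasicontinuous g)
    (hg : IsConvexFun g)
    (hpolar : ∀ d : X, (∀ xs ∈ dom g, xs d ≤ 0) → ∀ xs ∈ dom g, xs d = 0) :
    (0 : MackeyDual X) ∈ intrinsicInterior ℝ (dom g) := by
  by_contra hcon
  obtain ⟨F, hle, ys, hys, hlt⟩ := exists_forall_le_and_exists_lt_of_notMem_intrinsicInterior
    hg.convex_dom hq.isClosed_aff hq.ri_nonempty hcon
  obtain ⟨d, hd⟩ := exists_evalMackey_eq F
  have apply_d : ∀ xs : MackeyDual X, xs d = F xs := LinearMap.congr_fun hd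
  simp only [← apply_d] at hle hlt
  exact hlt.ne (hpolar d hle ys hys)

theorem exists_coe_eq_zero_of_mem_dom {x₀ : X} (hx₀ : x₀ ∈ dom (preconj g)) (h₀ : 0 ∈ dom g) :
    ∃ v : ℝ, g 0 = v := by
  have ne_bot : g 0 ≠ ⊥ := fun hbot => by
    have hle : ((0 : MackeyDual X) x₀ : EReal) - g 0 ≤ preconj g x₀ :=
      le_iSup (fun xs => ((xs x₀ : ℝ) : EReal) - g xs) 0
    rw [hbot, EReal.coe_sub_bot, top_le_iff] at hle
    exact (show preconj g x₀ < ⊤ from hx₀).ne hle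
  exact ⟨_, (EReal.coe_toReal (show g 0 < ⊤ from h₀).ne ne_bot).symm⟩

theorem IsQuasicontinuous.strong_duality [IsTopologicalAddGroup X] [ContinuousSMul ℝ X]
    [LocallyConvexSpace ℝ X] [T2Space X] (hq : IsQuasicontinuous g) (hg : IsConvexFun g)
    (hdom : (dom (preconj g)).Nonempty)
    (hrec : ∀ d, recessionFunction (preconj g) d ≤ 0 → recessionFunction (preconj g) (-d) ≤ 0) :
    ∃ m : ℝ, -g 0 = m ∧ ⨅ x, preconj g x = m ∧
      ∃ (C : Set X) (V : Submodule ℝ X), C.Nonempty ∧ Convex ℝ C ∧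
        IsCompact (toWeakSpace ℝ X '' C) ∧ FiniteDimensional ℝ V ∧
        {x | preconj g x ≤ m} = C + (V : Set X) := by
  obtain ⟨x₀, hx₀⟩ := hdom
  have zero_mem : (0 : MackeyDual X) ∈ intrinsicInterior ℝ (dom g) := by
    refine hq.zero_mem_intrinsicInterior hg fun d hd xs hxs => le_antisymm (hd xs hxs) ?_
    rw [← recessionFunction_preconj_nonpos_iff hx₀] at hd
    have hneg := (recessionFunction_preconj_nonpos_iff hx₀).1 (hrec d hd) xs hxs
    rwa [map_neg, neg_nonpos] at hneg
  obtain ⟨v, hv⟩ := exists_coe_eq_zero_of_mem_dom hx₀ (intrinsicInterior_subset zero_mem)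
  have sublevel_eq : {x | preconj g x ≤ ((-v : ℝ) : EReal)} = subdifferential g 0 :=
    Set.ext fun x => (mem_subdifferential_zero_iff hv).symm
  obtain ⟨C, V, hne, hC, hCc, hV, hCV⟩ := hq.exists_subdifferential_eq_add hg zero_mem hv
  refine ⟨-v, by rw [hv, EReal.coe_neg], le_antisymm ?_ ?_, C, V, hne, hC, hCc, hV,
    sublevel_eq.trans hCV⟩
  · obtain ⟨x, hx⟩ := hCV ▸ hne.add V.nonempty
    exact (iInf_le _ x).trans ((mem_subdifferential_zero_iff hv).1 hx)
  · refine le_iInf fun x => ?_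
    simpa [preconj, hv] using le_iSup (fun xs : MackeyDual X => ((xs x : ℝ) : EReal) - g xs) 0

end ConjugateDuality

section Problem

variable {X T : Type*} {f : X → EReal} {c : T → X → EReal} {𝓗 : Set (Finset T)}

/-- The objective of `(P)` with the constraints built in: `f x` at a feasible point `x`, and `⊤`
(the infimum over an empty family) elsewhere. -/
noncomputable def constrainedObjective (f : X → EReal) (c : T → X → EReal) (x : X) : EReal :=
  ⨅ _ : x ∈ feasibleSet c, f x

theorem constrainedObjective_of_mem {x : X} (hx : x ∈ feasibleSet c) :
    constrainedObjective f c x = f x :=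
  iInf_pos hx

theorem mem_feasibleSet_of_constrainedObjective_lt_top {x : X}
    (hx : constrainedObjective f c x < ⊤) : x ∈ feasibleSet c := by
  obtain ⟨hx, -⟩ := iInf_lt_iff.1 hx
  exact hx

theorem apply_eq_primalValue {x : X} (hx : x ∈ solutionSet f c) : f x = primalValue f c :=
  le_antisymm (le_iInf₂ hx.2) (iInf₂_le x hx.1)

theorem solutionSet_eq {m : ℝ} (hm : primalValue f c = m) :
    solutionSet f c = {x | constrainedObjective f c x ≤ m} := by
  ext x
  constructor
  · intro hx
    exact (constrainedObjective_of_mem hx.1).trans_le ((apply_eq_primalValue hx).trans hm).le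
  · intro hx
    have hfeas := mem_feasibleSet_of_constrainedObjective_lt_top
      (lt_of_le_of_lt hx (EReal.coe_lt_top m))
    refine ⟨hfeas, fun y hy => ?_⟩
    rw [← constrainedObjective_of_mem (f := f) hfeas]
    exact (show constrainedObjective f c x ≤ m from hx).trans (hm ▸ iInf₂_le y hy)

theorem lagrangian_le {x : X} (hx : x ∈ feasibleSet c) (H : Finset T) (μ : H → ℝ≥0) :
    lagrangian f c H μ x ≤ f x := by
  have sum_nonpos : ∑ t : H, ((μ t : ℝ) : EReal) * c t x ≤ 0 :=
    Finset.sum_nonpos fun t _ =>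
      EReal.mul_nonpos_iff.2 (Or.inl ⟨EReal.coe_nonneg.2 (μ t).2, hx t⟩)
  simpa only [lagrangian, add_zero] using add_le_add_right sum_nonpos (f x)

theorem lagrangian_zero (f : X → EReal) (c : T → X → EReal) (H : Finset T) (x : X) :
    lagrangian f c H 0 x = f x := by
  simp [lagrangian]

theorem lagrangian_single [DecidableEq T] (f : X → EReal) (c : T → X → EReal) {H : Finset T}
    (t : H) (n : ℝ≥0) (x : X) :
    lagrangian f c H (Pi.single t n) x = f x + ((n : ℝ) : EReal) * c t x := by
  rw [lagrangian, Finset.sum_eq_single t (fun s _ hs => by simp [Pi.single_eq_of_ne hs])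
    (by simp), Pi.single_eq_same]

theorem nonpos_of_forall_add_mul_le {u w : EReal} (hu : u ≠ ⊥) {a : ℝ}
    (h : ∀ n : ℝ≥0, u + ((n : ℝ) : EReal) * w ≤ a) : w ≤ 0 := by
  have hua : u ≤ a := by simpa using h 0
  lift u to ℝ using ⟨(hua.trans_lt (EReal.coe_lt_top a)).ne, hu⟩ with b
  induction w with
  | bot => exact bot_le
  | top => simpa using h 1
  | coe r =>
    by_contra! hr
    have hr : 0 < r := EReal.coe_pos.1 hr
    have hba : b ≤ a := EReal.coe_le_coe_iff.1 hua
    have hle := h (Real.toNNReal ((a - b + 1) / r))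
    rw [Real.coe_toNNReal _ (div_nonneg (by linarith) hr.le), ← EReal.coe_mul, ← EReal.coe_add,
      EReal.coe_le_coe_iff, div_mul_cancel₀ _ hr.ne'] at hle
    linarith

theorem iSup_lagrangian (hcov : IsCoveringFamily 𝓗) {x : X} (hfx : f x ≠ ⊥) :
    ⨆ H ∈ 𝓗, ⨆ μ : H → ℝ≥0, lagrangian f c H μ x = constrainedObjective f c x := by
  classical
  refine le_antisymm (iSup₂_le fun H _ => iSup_le fun μ => le_iInf fun hx => lagrangian_le hx H μ)
    (EReal.le_of_forall_lt_iff_le.1 fun a ha => ?_)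
  have lagrangian_le_coe : ∀ H ∈ 𝓗, ∀ μ : H → ℝ≥0, lagrangian f c H μ x ≤ a := fun H hH μ =>
    (le_iSup₂_of_le H hH (le_iSup (fun μ : H → ℝ≥0 => lagrangian f c H μ x) μ)).trans ha.le
  have hfeas : x ∈ feasibleSet c := fun t => by
    obtain ⟨H, hH, ht⟩ := hcov.covers t
    refine nonpos_of_forall_add_mul_le hfx (a := a) fun n => ?_
    rw [← lagrangian_single f c ⟨t, ht⟩ n x]
    exact lagrangian_le_coe H hH _
  obtain ⟨H, hH⟩ := hcov.nonempty
  rw [constrainedObjective_of_mem hfeas, ← lagrangian_zero f c H x]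
  exact lagrangian_le_coe H hH 0

variable [AddCommGroup X] [Module ℝ X]

variable [TopologicalSpace X]

theorem recessionFunction_constrainedObjective_nonpos_iff [ContinuousAdd X] [ContinuousSMul ℝ X]
    (hf : IsGamma f) (hc : ∀ t, IsGamma (c t)) (hfeas : (feasibleSet c ∩ dom f).Nonempty) {d : X} :
    recessionFunction (constrainedObjective f c) d ≤ 0 ↔ d ∈ problemRecessionCone f c := by
  rw [recessionFunction_nonpos_iff]
  constructor
  · intro hd
    obtain ⟨x₀, hx₀, hfx₀⟩ := hfeas
    obtain ⟨a, ha, -⟩ := EReal.lt_iff_exists_real_btwn.1 (show f x₀ < ⊤ from hfx₀)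
    have ray_le : ∀ r : ℝ, 0 ≤ r → constrainedObjective f c (x₀ + r • d) ≤ a := fun r hr =>
      (hd x₀ r hr).trans ((constrainedObjective_of_mem hx₀).trans_le ha.le)
    have ray_mem : ∀ r : ℝ, 0 ≤ r → x₀ + r • d ∈ feasibleSet c := fun r hr =>
      mem_feasibleSet_of_constrainedObjective_lt_top ((ray_le r hr).trans_lt (EReal.coe_lt_top a))
    exact ⟨fun t => (hc t).recessionFunction_nonpos (a := 0) fun r hr => ray_mem r hr t,
      hf.recessionFunction_nonpos fun r hr =>
        (constrainedObjective_of_mem (ray_mem r hr)).symm.trans_le (ray_le r hr)⟩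
  · rintro ⟨hct, hfd⟩ x r hr
    refine le_iInf fun hx => ?_
    have hmem : x + r • d ∈ feasibleSet c := fun t =>
      (recessionFunction_nonpos_iff.1 (hct t) x r hr).trans (hx t)
    rw [constrainedObjective_of_mem hmem]
    exact recessionFunction_nonpos_iff.1 hfd x r hr

theorem isGamma_lagrangian (hf : IsGamma f) (hc : ∀ t, IsGamma (c t))
    (hfeas : (feasibleSet c ∩ dom f).Nonempty) (H : Finset T) (μ : H → ℝ≥0) :
    IsGamma (lagrangian f c H μ) := by
  obtain ⟨x₀, hx₀, hfx₀⟩ := hfeas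
  have nonpos : ∀ t : H, ((μ t : ℝ) : EReal) * c t x₀ ≤ 0 := fun t =>
    EReal.mul_nonpos_iff.2 (Or.inl ⟨EReal.coe_nonneg.2 (μ t).2, hx₀ t⟩)
  exact hf.add (x₀ := x₀) (IsGamma.sum (x₀ := x₀) (fun t : H => (hc t).const_mul (μ t))
    (fun t => (nonpos t).trans_lt EReal.zero_lt_top) Finset.univ) hfx₀
    ((Finset.sum_nonpos fun t _ => nonpos t).trans_lt EReal.zero_lt_top)

theorem neg_iInf_eq_iSup_neg {ι : Sort*} (u : ι → EReal) : -⨅ i, u i = ⨆ i, -u i :=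
  EReal.negOrderIso.map_iInf u

theorem neg_conj_zero (h : X → EReal) : -conj h 0 = ⨅ x, h x := by
  simp [conj, ← neg_iInf_eq_iSup_neg]

theorem dualValue_eq_neg_phi_zero : dualValue f c 𝓗 = -phi f c 𝓗 0 := by
  simp only [dualValue, phi, neg_iInf_eq_iSup_neg, neg_conj_zero]

variable [IsTopologicalAddGroup X] [ContinuousSMul ℝ X] [LocallyConvexSpace ℝ X]

theorem preconj_phi (hf : IsGamma f) (hc : ∀ t, IsGamma (c t))
    (hfeas : (feasibleSet c ∩ dom f).Nonempty) (hcov : IsCoveringFamily 𝓗) :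
    preconj (phi f c 𝓗) = constrainedObjective f c := by
  funext x
  unfold phi
  simp only [preconj_iInf, (isGamma_lagrangian hf hc hfeas _ _).preconj_conj,
    iSup_lagrangian hcov (hf.ne_bot x)]

end Problem

end ConvexInfinite

open ConvexInfinite in
theorem theorem4 {X T : Type*} [AddCommGroup X] [Module ℝ X] [TopologicalSpace X]
    [IsTopologicalAddGroup X] [ContinuousSMul ℝ X] [LocallyConvexSpace ℝ X] [T2Space X]
    (f : X → EReal) (c : T → X → EReal) (𝓗 : Set (Finset T))
    (hf : ConvexInfinite.IsGamma f) (hc : ∀ t, ConvexInfinite.IsGamma (c t))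
    (hfeas : (ConvexInfinite.feasibleSet c ∩ ConvexInfinite.dom f).Nonempty)
    (hcov : ConvexInfinite.IsCoveringFamily 𝓗)
    (hconv : ConvexInfinite.IsConvexFun (ConvexInfinite.phi f c 𝓗))
    (hquasi : ConvexInfinite.IsQuasicontinuous (ConvexInfinite.phi f c 𝓗))
    (hrec : ∃ L : Submodule ℝ X, (L : Set X) = ConvexInfinite.problemRecessionCone f c) :
    (∃ m : ℝ,
      (∃ x ∈ ConvexInfinite.solutionSet f c, f x = (m : EReal)) ∧
      ConvexInfinite.primalValue f c = (m : EReal) ∧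
      ConvexInfinite.dualValue f c 𝓗 = (m : EReal)) ∧
    ∃ (C : Set X) (V : Submodule ℝ X),
      Convex ℝ C ∧ IsCompact (toWeakSpace ℝ X '' C) ∧ FiniteDimensional ℝ V ∧
      ConvexInfinite.solutionSet f c = C + (V : Set X) := by
  obtain ⟨L, hL⟩ := hrec
  have hpre : preconj (phi f c 𝓗) = constrainedObjective f c := preconj_phi hf hc hfeas hcov
  have rec_iff : ∀ d, recessionFunction (constrainedObjective f c) d ≤ 0 ↔ d ∈ L := fun d => by
    rw [recessionFunction_constrainedObjective_nonpos_iff hf hc hfeas, ← hL, SetLike.mem_coe]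
  have hdom : (dom (constrainedObjective f c)).Nonempty :=
    hfeas.mono fun x hx => (constrainedObjective_of_mem hx.1).trans_lt hx.2
  obtain ⟨m, hdual, hprimal, C, V, hne, hC, hCc, hV, hCV⟩ := hquasi.strong_duality hconv
    (hpre ▸ hdom) fun d => by
      rw [hpre, rec_iff, rec_iff]
      exact L.neg_mem
  have value_eq : primalValue f c = m := by
    rw [← hprimal, hpre]
    rfl
  have sol_eq : solutionSet f c = C + (V : Set X) := by rw [solutionSet_eq value_eq, ← hpre, hCV]
  obtain ⟨x, hx⟩ : (solutionSet f c).Nonempty := sol_eq ▸ hne.add V.nonempty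
  exact ⟨⟨m, ⟨x, hx, (apply_eq_primalValue hx).trans value_eq⟩, value_eq,
    dualValue_eq_neg_phi_zero.trans hdual⟩, C, V, hC, hCc, hV, sol_eq⟩
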